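/- All manifolds are smooth and finite-dimensional and all tensor fields are smooth. An almost product structure on $M$ is a $(1,1)$-tensor field $P$ with $P^2=I$; its Nijenhuis tensor is $N_P(X,Y)=P^2[X,Y]+[PX,PY]-P[PX,Y]-P[X,PY]$. Its eigendistributions are $E_{(\pm1)}(P)=\ker(P\mp I)$. Metrics are nondegenerate, and $\nabla$ denotes the Levi-Civita connection. For a metric $h$ and an almost product structure $P$ put $$(\phi_P h)(X,Y,Z)=(PX)(h(Y,Z))-X(h(PY,Z))+h((L_YP)X,Z)+h(Y,(L_ZP)X),$$ $$(\Psi_P h)(X,Y,Z)=(\phi_P h)(X,Y,Z)+(\phi_P h)(Z,Y,X).$$ * $(M,h,P)$ is a *locally decomposable product Riemannian manifold* if $h$ is a Riemannian metric with $h(PX,Y)=h(X,PY)$, $P$ is integrable ($N_P=0$), and $(\Psi_P h)(X,Y,Z)=(\Psi_P h)(Y,X,Z)+(\Psi_P h)(PY,PX,Z)$ for all vector fields $X,Y,Z$ (that is, $P$ is parallel). * $(N,g,Q)$ is a *nearly para-Kaehler manifold* if $g$ is a (nondegenerate, semi-Riemannian) metric with $g(QX,Y)=-g(X,QY)$, $Q$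 is an almost product structure, and $(\nabla_XQ)X=0$ for every vector field $X$. * A smooth map $F:(M,P)\to(N,Q)$ is *$\pm(P,Q)$-paraholomorphic* if $F_*\circ P=Q\circ F_*$ on all of $M$, or $F_*\circ P=-Q\circ F_*$ on all of $M$. * The second fundamental form of $F:(M,h)\to(N,g)$ is $(\nabla F_*)(X,Y)=\nabla^F_X(F_*Y)-F_*(\nabla_XY)$, where $\nabla^F$ is the pull-back to $F^{-1}TN$ of the Levi-Civita connection of $g$. For a distribution $D$ on $M$ on which $h$ is nondegenerate, the $D$-tension field is $\tau_D(F)=\sum_{i,j}h^{ij}(\nabla F_*)(e_i,e_j)$, where $(e_i)$ is a local frame of $D$ and $(h^{ij})$ is the inverse of the matrix $(h(e_i,e_j))$. $F$ is *harmonic*, *plus-eigen harmonic*, *minus-eigen harmonic* if $\tau_D(F)=0$ for $D=TM$, $D=E_{(1)}(P)$, $D=E_{(-1)}(P)$, respectively. **Corollary.** Let $(M,h,P)$ be a locally decomposable product Riemannian manifold, let $(N,g,Q)$ be either a locally decomposable product Riemannian manifold or a nearly para-Kaehler manifold, and let $F:M\to N$ be a smooth $\pm(P,Q)$-paraholomorphic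 map. Then $F$ is harmonic if and only if $F$ is both plus-eigen harmonic and minus-eigen harmonic. -/

import Mathlib

open Bundle Manifold
open scoped ContDiff Topology

noncomputable section

namespace ProductGeometry

section Geometry

variable {E : Type*} [NormedAddCommGroup E] [NormedSpace ℝ E]
  {M : Type*} [TopologicalSpace M] [ChartedSpace E M] [IsManifold 𝓘(ℝ, E) ∞ M]

variable (E M) in
/-- A smooth nondegenerate symmetric `(0,2)`-tensor field, i.e. a semi-Riemannian metric. -/
structure SemiRiemannianMetric where
  val (p : M) : TangentSpace 𝓘(ℝ, E) p →L[ℝ] TangentSpace 𝓘(ℝ, E) p →L[ℝ] ℝ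
  contMDiff : ContMDiff 𝓘(ℝ, E) (𝓘(ℝ, E).prod 𝓘(ℝ, E →L[ℝ] E →L[ℝ] ℝ)) ∞
    (fun p ↦ TotalSpace.mk' (E →L[ℝ] E →L[ℝ] ℝ)
      (E := fun x : M ↦ (TangentSpace 𝓘(ℝ, E) x →L[ℝ] TangentSpace 𝓘(ℝ, E) x →L[ℝ] ℝ)) p (val p))
  symm (p : M) (v w : TangentSpace 𝓘(ℝ, E) p) : val p v w = val p w v
  nondegenerate (p : M) (v : TangentSpace 𝓘(ℝ, E) p) : (∀ w, val p v w = 0) → v = 0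

namespace SemiRiemannianMetric

variable (g : SemiRiemannianMetric E M)

instance : CoeFun (SemiRiemannianMetric E M)
    (fun _ ↦ (p : M) → TangentSpace 𝓘(ℝ, E) p →L[ℝ] TangentSpace 𝓘(ℝ, E) p →L[ℝ] ℝ) := ⟨val⟩

/-- The metric is Riemannian, i.e. positive definite. -/
def IsRiemannian : Prop := ∀ (p : M) (v : TangentSpace 𝓘(ℝ, E) p), v ≠ 0 → 0 < g p v v

/-- The metric at a point, as a bilinear form. -/
def bilin (p : M) : LinearMap.BilinForm ℝ (TangentSpace 𝓘(ℝ, E) p) :=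
  LinearMap.mk₂ ℝ (fun v w ↦ g p v w) (by simp) (by simp) (by simp) (by simp)

lemma bilin_nondegenerate (p : M) : (g.bilin p).Nondegenerate :=
  ⟨fun v hv ↦ g.nondegenerate p v hv,
    fun v hv ↦ g.nondegenerate p v fun w ↦ (g.symm p v w).trans (hv w)⟩

lemma mdifferentiableAt_apply {p : M} {X Y : ∀ x : M, TangentSpace 𝓘(ℝ, E) x}
    (hX : MDiffAt (T% X) p) (hY : MDiffAt (T% Y) p) :
    MDiffAt (fun x ↦ g x (X x) (Y x)) p := by
  have h1 : MDifferentiableAt 𝓘(ℝ, E) (𝓘(ℝ, E).prod 𝓘(ℝ, ℝ)) 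
      (fun x ↦ TotalSpace.mk' ℝ (E := Bundle.Trivial M ℝ) x (g x (X x) (Y x))) p := by
    apply MDifferentiableAt.clm_bundle_apply₂ (F₁ := E) (F₂ := E)
    · exact (g.contMDiff.contMDiffAt).mdifferentiableAt (by simp)
    · exact hX
    · exact hY
  simp only [mdifferentiableAt_totalSpace] at h1
  exact h1.2

end SemiRiemannianMetric

/-- The coordinate vector field through `v ∈ T_p M`: the local vector field whose components in the
preferred chart at `p` are constant (it is zero outside the domain of that chart). -/
def coordField {p : M} (v : TangentSpace 𝓘(ℝ, E) p) (x : M) : TangentSpace 𝓘(ℝ, E) x :=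
  (trivializationAt E (TangentSpace 𝓘(ℝ, E)) p).symmL ℝ x
    ((trivializationAt E (TangentSpace 𝓘(ℝ, E)) p).continuousLinearMapAt ℝ p v)

lemma coordField_self {p : M} (v : TangentSpace 𝓘(ℝ, E) p) : coordField v p = v :=
  (trivializationAt E (TangentSpace 𝓘(ℝ, E)) p).symmL_continuousLinearMapAt
    (FiberBundle.mem_baseSet_trivializationAt' p) v

lemma coordField_add {p : M} (v w : TangentSpace 𝓘(ℝ, E) p) (x : M) :
    coordField (v + w) x = coordField v x + coordField w x := by
  simp only [coordField, map_add]

lemma coordField_smul {p : M} (c : ℝ) (v : TangentSpace 𝓘(ℝ, E) p) (x : M) :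
    coordField (c • v) x = c • coordField v x := by
  simp only [coordField, map_smul]

lemma contMDiffAt_coordField {p : M} (v : TangentSpace 𝓘(ℝ, E) p) :
    ContMDiffAt 𝓘(ℝ, E) (𝓘(ℝ, E).prod 𝓘(ℝ, E)) ∞ (fun x ↦ TotalSpace.mk' E x (coordField v x)) p := by
  have hp := FiberBundle.mem_baseSet_trivializationAt' (F := E) (E := TangentSpace 𝓘(ℝ, E)) p
  refine (FiberBundle.contMDiffAt_extend (k := ∞) 𝓘(ℝ, E) E v).congr_of_eventuallyEq ?_
  filter_upwards [(trivializationAt E (TangentSpace 𝓘(ℝ, E)) p).open_baseSet.mem_nhds hp] with x hx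
  simp [coordField, FiberBundle.extend,
    Trivialization.coe_linearMapAt_of_mem _ hp, Trivialization.symmL_apply _ hx]

namespace SemiRiemannianMetric
variable (g : SemiRiemannianMetric E M)

lemma mdifferentiableAt_coordField {p : M} (v w : TangentSpace 𝓘(ℝ, E) p) :
    MDiffAt (fun x ↦ g x (coordField v x) (coordField w x)) p :=
  g.mdifferentiableAt_apply ((contMDiffAt_coordField v).mdifferentiableAt (by simp))
    ((contMDiffAt_coordField w).mdifferentiableAt (by simp))

/-- `∂_u (g(v, w))` at `p`, in the preferred chart at `p`. -/
def partialDeriv (p : M) (u v w : TangentSpace 𝓘(ℝ, E) p) : ℝ :=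
  mvfderiv 𝓘(ℝ, E) (fun x ↦ g x (coordField v x) (coordField w x)) p u

lemma partialDeriv_add_left (p : M) (u v v' w : TangentSpace 𝓘(ℝ, E) p) :
    g.partialDeriv p u (v + v') w = g.partialDeriv p u v w + g.partialDeriv p u v' w := by
  simp only [partialDeriv, coordField_add, map_add, add_apply]
  exact congrArg (· u)
    (mvfderiv_add (g.mdifferentiableAt_coordField v w) (g.mdifferentiableAt_coordField v' w))

lemma partialDeriv_symm (p : M) (u v w : TangentSpace 𝓘(ℝ, E) p) :
    g.partialDeriv p u v w = g.partialDeriv p u w v := by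
  simp only [partialDeriv, g.symm]

lemma partialDeriv_smul_left (p : M) (c : ℝ) (u v w : TangentSpace 𝓘(ℝ, E) p) :
    g.partialDeriv p u (c • v) w = c * g.partialDeriv p u v w := by
  simp only [partialDeriv, coordField_smul, map_smul, smul_apply]
  have h := mvfderiv_smul (mdifferentiableAt_const (I := 𝓘(ℝ, E)) (c := c))
    (g.mdifferentiableAt_coordField v w)
  rw [mvfderiv_const] at h
  refine (congrArg (· u) h).trans ?_
  simp

lemma partialDeriv_add_right (p : M) (u v w w' : TangentSpace 𝓘(ℝ, E) p) :
    g.partialDeriv p u v (w + w') = g.partialDeriv p u v w + g.partialDeriv p u v w' := by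
  rw [partialDeriv_symm, partialDeriv_add_left, g.partialDeriv_symm p u w, 
    g.partialDeriv_symm p u w']

lemma partialDeriv_smul_right (p : M) (c : ℝ) (u v w : TangentSpace 𝓘(ℝ, E) p) :
    g.partialDeriv p u v (c • w) = c * g.partialDeriv p u v w := by
  rw [partialDeriv_symm, partialDeriv_smul_left, g.partialDeriv_symm p u w]

lemma partialDeriv_add (p : M) (u u' v w : TangentSpace 𝓘(ℝ, E) p) :
    g.partialDeriv p (u + u') v w = g.partialDeriv p u v w + g.partialDeriv p u' v w :=
  map_add _ _ _

lemma partialDeriv_smul (p : M) (c : ℝ) (u v w : TangentSpace 𝓘(ℝ, E) p) :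
    g.partialDeriv p (c • u) v w = c * g.partialDeriv p u v w :=
  map_smul _ _ _

/-- Christoffel symbols of the first kind:
`½ (∂_u g(v, w) + ∂_v g(u, w) - ∂_w g(u, v))`, as a linear form in `w`. -/
def christoffelFirst (p : M) :
    TangentSpace 𝓘(ℝ, E) p →ₗ[ℝ] TangentSpace 𝓘(ℝ, E) p →ₗ[ℝ]
      Module.Dual ℝ (TangentSpace 𝓘(ℝ, E) p) :=
  LinearMap.mk₂ ℝ
    (fun u v ↦
      { toFun := fun w ↦ (1 / 2 : ℝ) * (g.partialDeriv p u v w + g.partialDeriv p v u w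
          - g.partialDeriv p w u v)
        map_add' := fun w w' ↦ by
          rw [partialDeriv_add_right, partialDeriv_add_right, partialDeriv_add]; ring
        map_smul' := fun c w ↦ by
          rw [partialDeriv_smul_right, partialDeriv_smul_right, partialDeriv_smul, smul_eq_mul,
            RingHom.id_apply]; ring })
    (fun u u' v ↦ LinearMap.ext fun w ↦ by
      simp only [LinearMap.coe_mk, AddHom.coe_mk, LinearMap.add_apply]
      rw [partialDeriv_add, partialDeriv_add_left, partialDeriv_add_left]; ring)
    (fun c u v ↦ LinearMap.ext fun w ↦ by
      simp only [LinearMap.coe_mk, AddHom.coe_mk, LinearMap.smul_apply, smul_eq_mul]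
      rw [partialDeriv_smul, partialDeriv_smul_left, partialDeriv_smul_left]; ring)
    (fun u v v' ↦ LinearMap.ext fun w ↦ by
      simp only [LinearMap.coe_mk, AddHom.coe_mk, LinearMap.add_apply]
      rw [partialDeriv_add, partialDeriv_add_left, partialDeriv_add_right]; ring)
    (fun c u v ↦ LinearMap.ext fun w ↦ by
      simp only [LinearMap.coe_mk, AddHom.coe_mk, LinearMap.smul_apply, smul_eq_mul]
      rw [partialDeriv_smul, partialDeriv_smul_left, partialDeriv_smul_right]; ring)

variable [FiniteDimensional ℝ E]

instance (p : M) : FiniteDimensional ℝ (TangentSpace 𝓘(ℝ, E) p) :=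
  inferInstanceAs (FiniteDimensional ℝ E)

instance (p : M) : T2Space (TangentSpace 𝓘(ℝ, E) p) := inferInstanceAs (T2Space E)

/-- Christoffel symbols of the second kind: `g(Γ(u, v), w) = christoffelFirst u v w`. -/
def christoffel (p : M) :
    TangentSpace 𝓘(ℝ, E) p →ₗ[ℝ] TangentSpace 𝓘(ℝ, E) p →ₗ[ℝ] TangentSpace 𝓘(ℝ, E) p :=
  (g.christoffelFirst p).compr₂ ((g.bilin p).toDual (g.bilin_nondegenerate p)).symm.toLinearMap

lemma apply_christoffel (p : M) (u v w : TangentSpace 𝓘(ℝ, E) p) :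
    g p (g.christoffel p u v) w = (1 / 2 : ℝ) * (g.partialDeriv p u v w + g.partialDeriv p v u w
          - g.partialDeriv p w u v) :=
  LinearMap.BilinForm.apply_toDual_symm_apply (hB := g.bilin_nondegenerate p) _ _
end SemiRiemannianMetric

/-- The components, in the preferred chart at `q`, of a tangent vector at `y`. -/
def coords (q : M) {y : M} (v : TangentSpace 𝓘(ℝ, E) y) : E :=
  (trivializationAt E (TangentSpace 𝓘(ℝ, E)) q).continuousLinearMapAt ℝ y v


lemma coords_self {q : M} (v : TangentSpace 𝓘(ℝ, E) q) : coords q v = v := by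
  simp only [coords, TangentBundle.continuousLinearMapAt_trivializationAt_eq_core (mem_chart_source E q)]
  exact (tangentBundleCore 𝓘(ℝ, E) M).coordChange_self _ _ (mem_chart_source E q) v

/-- The directional derivatives at `p` of the components of a vector field `Y`, in the preferred chart at `p`. -/
def coordDeriv (Y : ∀ x : M, TangentSpace 𝓘(ℝ, E) x) (p : M) :
    TangentSpace 𝓘(ℝ, E) p →L[ℝ] TangentSpace 𝓘(ℝ, E) p :=
  mvfderiv 𝓘(ℝ, E) (fun x ↦ coords p (Y x)) p

lemma mdifferentiableAt_coords {Y : ∀ x : M, TangentSpace 𝓘(ℝ, E) x} {p : M} (hY : MDiffAt (T% Y) p) :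
    MDiffAt (fun x ↦ coords p (Y x)) p := by
  have hp := FiberBundle.mem_baseSet_trivializationAt' (F := E) (E := TangentSpace 𝓘(ℝ, E)) p
  rw [mdifferentiableAt_section] at hY
  refine hY.congr_of_eventuallyEq ?_
  filter_upwards [(trivializationAt E (TangentSpace 𝓘(ℝ, E)) p).open_baseSet.mem_nhds hp] with x hx
  simp [coords, Trivialization.coe_linearMapAt_of_mem _ hx]

namespace SemiRiemannianMetric
variable [FiniteDimensional ℝ E] (g : SemiRiemannianMetric E M)

/-- The Levi-Civita connection: in the preferred chart at `p`,
`(∇_u Y)(p) = ∂_u Y + Γ_p(u, Y(p))`. It is the torsion-free metric connection, see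
`leviCivita_metric` and `leviCivita_torsionFree`. -/
def leviCivita : CovariantDerivative 𝓘(ℝ, E) E (TangentSpace 𝓘(ℝ, E) : M → Type _) where
  toFun Y p := coordDeriv Y p + LinearMap.toContinuousLinearMap ((g.christoffel p).flip (Y p))
  isCovariantDerivativeOnUniv := by
    constructor
    · intro Y Y' p hY hY' _
      ext u
      have h := mvfderiv_add (mdifferentiableAt_coords hY) (mdifferentiableAt_coords hY')
      have h' : coordDeriv (Y + Y') p = coordDeriv Y p + coordDeriv Y' p := by
        simp only [coordDeriv, Pi.add_apply, coords, map_add] at h ⊢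
        exact h
      simp only [h', add_apply, Pi.add_apply, map_add]
      abel
    · intro Y f p hY hf _
      ext u
      have h := mvfderiv_smul hf (mdifferentiableAt_coords hY)
      rw [coords_self] at h
      have h' : coordDeriv (f • Y) p = f p • coordDeriv Y p + 
          (mvfderiv 𝓘(ℝ, E) f p).smulRight (Y p) := by
        simp only [coordDeriv, Pi.smul_apply', coords, map_smul] at h ⊢
        exact h
      simp only [h', add_apply, smul_apply, Pi.smul_apply', map_smul, smul_add]
      abel


lemma leviCivita_apply (Y : ∀ x : M, TangentSpace 𝓘(ℝ, E) x) (p : M) (u : TangentSpace 𝓘(ℝ, E) p) :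
    g.leviCivita Y p u = coordDeriv Y p u + g.christoffel p u (Y p) := rfl

end SemiRiemannianMetric

lemma coords_coordField {p : M} (v : TangentSpace 𝓘(ℝ, E) p) {x : M}
    (hx : x ∈ (trivializationAt E (TangentSpace 𝓘(ℝ, E)) p).baseSet) :
    coords p (coordField v x) = v := by
  rw [coords, coordField, Trivialization.continuousLinearMapAt_symmL _ hx]
  exact coords_self v

lemma coordDeriv_coordField {p : M} (v : TangentSpace 𝓘(ℝ, E) p) : coordDeriv (coordField v) p = 0 := by
  have hp := FiberBundle.mem_baseSet_trivializationAt' (F := E) (E := TangentSpace 𝓘(ℝ, E)) p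
  have : (fun x ↦ coords p (coordField v x)) =ᶠ[𝓝 p] fun _ ↦ v := by
    filter_upwards [(trivializationAt E (TangentSpace 𝓘(ℝ, E)) p).open_baseSet.mem_nhds hp] with x hx
    exact coords_coordField v hx
  have h2 := this.mfderiv_eq (I := 𝓘(ℝ, E)) (I' := 𝓘(ℝ, E))
  ext u
  exact (congrArg (· u) h2).trans
    (congrArg (· u) (mfderiv_const (I := 𝓘(ℝ, E)) (I' := 𝓘(ℝ, E)) (M' := E) (x := p) (c := v)))

lemma mlieBracket_coordField {p : M} (v w : TangentSpace 𝓘(ℝ, E) p) :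
    VectorField.mlieBracket 𝓘(ℝ, E) (coordField v) (coordField w) p = 0 := by
  have key (v : TangentSpace 𝓘(ℝ, E) p) :
      VectorField.mpullbackWithin 𝓘(ℝ, E) 𝓘(ℝ, E) (extChartAt 𝓘(ℝ, E) p).symm (coordField v)
        (Set.range 𝓘(ℝ, E)) =ᶠ[𝓝 (extChartAt 𝓘(ℝ, E) p p)] fun _ ↦ v := by
    filter_upwards [extChartAt_target_mem_nhds (I := 𝓘(ℝ, E)) p] with y hy
    have hx : (extChartAt 𝓘(ℝ, E) p).symm y ∈ (chartAt E p).source := by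
      simpa using (extChartAt 𝓘(ℝ, E) p).map_target hy
    have h := TangentBundle.symmL_trivializationAt (I := 𝓘(ℝ, E)) hx
    rw [(extChartAt 𝓘(ℝ, E) p).right_inv hy] at h
    have h' : coordField v ((extChartAt 𝓘(ℝ, E) p).symm y) =
      mfderivWithin 𝓘(ℝ, E) 𝓘(ℝ, E) (extChartAt 𝓘(ℝ, E) p).symm (Set.range 𝓘(ℝ, E)) y v := by
      rw [← h]
      exact congrArg _ (coords_self v)
    rw [VectorField.mpullbackWithin_apply, h']
    exact (isInvertible_mfderivWithin_extChartAt_symm hy).inverse_apply_self v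
  rw [← VectorField.mlieBracketWithin_univ, VectorField.mlieBracketWithin_apply]
  have h0 : VectorField.lieBracketWithin ℝ
      (VectorField.mpullbackWithin 𝓘(ℝ, E) 𝓘(ℝ, E) (extChartAt 𝓘(ℝ, E) p).symm (coordField v)
        (Set.range 𝓘(ℝ, E)))
      (VectorField.mpullbackWithin 𝓘(ℝ, E) 𝓘(ℝ, E) (extChartAt 𝓘(ℝ, E) p).symm (coordField w)
        (Set.range 𝓘(ℝ, E)))
      ((extChartAt 𝓘(ℝ, E) p).symm ⁻¹' Set.univ ∩ Set.range 𝓘(ℝ, E)) (extChartAt 𝓘(ℝ, E) p p) =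
      VectorField.lieBracketWithin ℝ (fun _ : E ↦ (v : E)) (fun _ : E ↦ (w : E))
      ((extChartAt 𝓘(ℝ, E) p).symm ⁻¹' Set.univ ∩ Set.range 𝓘(ℝ, E)) (extChartAt 𝓘(ℝ, E) p p) :=
    Filter.EventuallyEq.lieBracketWithin_vectorField_eq_nhds (E := E) (key v) (key w)
  have h1 (s : Set E) (y a b : E) :
      VectorField.lieBracketWithin ℝ (fun _ : E ↦ a) (fun _ : E ↦ b) s y = 0 := by
    simp [VectorField.lieBracketWithin]
  exact (congrArg (mfderiv 𝓘(ℝ, E) 𝓘(ℝ, E) (extChartAt 𝓘(ℝ, E) p) p).inverse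
    (h0.trans (h1 _ _ v w))).trans (map_zero _)

namespace SemiRiemannianMetric
variable [FiniteDimensional ℝ E] (g : SemiRiemannianMetric E M)

lemma partialDeriv_eq (p : M) (u v w : TangentSpace 𝓘(ℝ, E) p) :
    g.partialDeriv p u v w = g p (g.christoffel p u v) w + g p v (g.christoffel p u w) := by
  rw [g.symm p v, apply_christoffel, apply_christoffel, g.partialDeriv_symm p u w v,
    g.partialDeriv_symm p v u w, g.partialDeriv_symm p w u v]
  ring

lemma christoffel_symm (p : M) (u v : TangentSpace 𝓘(ℝ, E) p) :
    g.christoffel p u v = g.christoffel p v u := by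
  refine sub_eq_zero.mp (g.nondegenerate p _ fun w ↦ ?_)
  rw [map_sub, sub_apply, apply_christoffel, apply_christoffel, g.partialDeriv_symm p w u v]
  ring

/-- The connection is metric: `u(g(Y, Z)) = g(∇_u Y, Z) + g(Y, ∇_u Z)`. -/
theorem leviCivita_metric {p : M} {Y Z : ∀ x : M, TangentSpace 𝓘(ℝ, E) x}
    (hY : MDiffAt (T% Y) p) (hZ : MDiffAt (T% Z) p) (u : TangentSpace 𝓘(ℝ, E) p) :
    mvfderiv 𝓘(ℝ, E) (fun x ↦ g x (Y x) (Z x)) p u =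
      g p (g.leviCivita Y p u) (Z p) + g p (Y p) (g.leviCivita Z p u) := by
  have key : ∀ Y Z : ∀ x : M, TangentSpace 𝓘(ℝ, E) x, MDiffAt (T% Z) p → TensorialAt 𝓘(ℝ, E) E
      (fun Y ↦ mvfderiv 𝓘(ℝ, E) (fun x ↦ g x (Y x) (Z x)) p u -
      (g p (g.leviCivita Y p u) (Z p) + g p (Y p) (g.leviCivita Z p u))) p := by
    intro Y Z hZ
    constructor
    · intro f Y hf hY
      have h := congrArg (· u) (mvfderiv_smul hf (g.mdifferentiableAt_apply hY hZ))
      have h' : mvfderiv 𝓘(ℝ, E) (fun x ↦ g x ((f • Y) x) (Z x)) p u = 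
          f p * mvfderiv 𝓘(ℝ, E) (fun x ↦ g x (Y x) (Z x)) p u + mvfderiv 𝓘(ℝ, E) f p u * g p (Y p) (Z p) := by
        simp only [Pi.smul_apply', map_smul, smul_apply]
        exact h
      rw [h', g.leviCivita.isCovariantDerivativeOnUniv.leibniz hY hf]
      simp
      ring
    · intro Y Y' hY hY'
      have h := congrArg (· u) (mvfderiv_add (g.mdifferentiableAt_apply hY hZ) (g.mdifferentiableAt_apply hY' hZ))
      have h' : mvfderiv 𝓘(ℝ, E) (fun x ↦ g x ((Y + Y') x) (Z x)) p u = 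
          mvfderiv 𝓘(ℝ, E) (fun x ↦ g x (Y x) (Z x)) p u + mvfderiv 𝓘(ℝ, E) (fun x ↦ g x (Y' x) (Z x)) p u := by
        simp only [Pi.add_apply, map_add, add_apply]
        exact h
      rw [h', g.leviCivita.isCovariantDerivativeOnUniv.add hY hY']
      simp
      ring
  have hcf (v : TangentSpace 𝓘(ℝ, E) p) : MDiffAt (T% (coordField v)) p :=
    (contMDiffAt_coordField v).mdifferentiableAt (by simp)
  have h1 := (key Y Z hZ).pointwise hY (hcf (Y p)) (coordField_self _).symm
  have h2 := (key Z (coordField (Y p)) (hcf _)).pointwise hZ (hcf (Z p)) (coordField_self _).symm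
  have h3 : mvfderiv 𝓘(ℝ, E) (fun x ↦ g x (coordField (Z p) x) (coordField (Y p) x)) p u =
    g.partialDeriv p u (Z p) (Y p) := rfl
  simp only [leviCivita_apply, coordDeriv_coordField, coordField_self, h3, partialDeriv_eq] at h1 h2
  simp only [g.symm _ (Z _) (coordField _ _), g.symm p (Z p)] at h2
  simp only [leviCivita_apply]
  simp at h1 h2 ⊢
  rw [g.symm p (coordDeriv Z p u), g.symm p (g.christoffel p u (Z p)) (Y p)] at h2
  linarith

/-- The connection is torsion-free: `∇_X Y - ∇_Y X = [X, Y]`. -/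
theorem leviCivita_torsionFree {p : M} {X Y : ∀ x : M, TangentSpace 𝓘(ℝ, E) x}
    (hX : MDiffAt (T% X) p) (hY : MDiffAt (T% Y) p) :
    g.leviCivita Y p (X p) - g.leviCivita X p (Y p) = VectorField.mlieBracket 𝓘(ℝ, E) X Y p := by
  have : CompleteSpace E := FiniteDimensional.complete ℝ E
  have ht : g.leviCivita.torsion = 0 := by
    ext p u v
    have hcf (v : TangentSpace 𝓘(ℝ, E) p) : MDiffAt (T% (coordField v)) p :=
      (contMDiffAt_coordField v).mdifferentiableAt (by simp)
    have h := g.leviCivita.torsion_apply (hcf u) (hcf v)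
    rw [mlieBracket_coordField, leviCivita_apply, leviCivita_apply, coordDeriv_coordField,
      coordDeriv_coordField, coordField_self, coordField_self, g.christoffel_symm p u v] at h
    simpa using h
  exact g.leviCivita.torsion_eq_zero_iff.mp ht hX hY

end SemiRiemannianMetric
/-- The vector field `X` is smooth near `p`. -/
def SmoothFieldAt (X : ∀ x : M, TangentSpace 𝓘(ℝ, E) x) (p : M) : Prop :=
  ContMDiffAt 𝓘(ℝ, E) (𝓘(ℝ, E).prod 𝓘(ℝ, E)) ∞ (fun x ↦ TotalSpace.mk' E x (X x)) p

variable (E M) in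
/-- An almost product structure: a smooth `(1,1)`-tensor field `P` with `P² = I`. -/
structure AlmostProductStructure where
  val (p : M) : TangentSpace 𝓘(ℝ, E) p →L[ℝ] TangentSpace 𝓘(ℝ, E) p
  contMDiff : ContMDiff 𝓘(ℝ, E) (𝓘(ℝ, E).prod 𝓘(ℝ, E →L[ℝ] E)) ∞
    (fun p ↦ TotalSpace.mk' (E →L[ℝ] E)
      (E := fun x : M ↦ (TangentSpace 𝓘(ℝ, E) x →L[ℝ] TangentSpace 𝓘(ℝ, E) x)) p (val p))
  sq (p : M) (v : TangentSpace 𝓘(ℝ, E) p) : val p (val p v) = v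

instance : CoeFun (AlmostProductStructure E M)
    (fun _ ↦ (p : M) → TangentSpace 𝓘(ℝ, E) p →L[ℝ] TangentSpace 𝓘(ℝ, E) p) :=
  ⟨AlmostProductStructure.val⟩

namespace AlmostProductStructure

variable (P : AlmostProductStructure E M)

/-- The vector field `P X`. -/
def field (X : ∀ x : M, TangentSpace 𝓘(ℝ, E) x) (x : M) : TangentSpace 𝓘(ℝ, E) x := P x (X x)

/-- The eigendistribution of `P` for the eigenvalue `c`. -/
def eigendistribution (c : ℝ) (p : M) : Submodule ℝ (TangentSpace 𝓘(ℝ, E) p) :=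
  Module.End.eigenspace (P p : TangentSpace 𝓘(ℝ, E) p →ₗ[ℝ] TangentSpace 𝓘(ℝ, E) p) c

/-- The Nijenhuis tensor
`N_P(X, Y) = P²[X, Y] + [PX, PY] - P[PX, Y] - P[X, PY]`. -/
def nijenhuis (X Y : ∀ x : M, TangentSpace 𝓘(ℝ, E) x) (p : M) : TangentSpace 𝓘(ℝ, E) p :=
  P p (P p (VectorField.mlieBracket 𝓘(ℝ, E) X Y p))
    + VectorField.mlieBracket 𝓘(ℝ, E) (P.field X) (P.field Y) p
    - P p (VectorField.mlieBracket 𝓘(ℝ, E) (P.field X) Y p)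
    - P p (VectorField.mlieBracket 𝓘(ℝ, E) X (P.field Y) p)

/-- `P` is integrable: its Nijenhuis tensor vanishes. -/
def IsIntegrable : Prop :=
  ∀ (p : M) (X Y : ∀ x : M, TangentSpace 𝓘(ℝ, E) x),
    SmoothFieldAt X p → SmoothFieldAt Y p → P.nijenhuis X Y p = 0

/-- The Lie derivative `(L_Y P) X = [Y, PX] - P[Y, X]`. -/
def lieDeriv (Y X : ∀ x : M, TangentSpace 𝓘(ℝ, E) x) (p : M) : TangentSpace 𝓘(ℝ, E) p :=
  VectorField.mlieBracket 𝓘(ℝ, E) Y (P.field X) p - P p (VectorField.mlieBracket 𝓘(ℝ, E) Y X p)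

variable (h : SemiRiemannianMetric E M)

/-- The Tachibana operator applied to `h`:
`(φ_P h)(X, Y, Z) = (PX)(h(Y, Z)) - X(h(PY, Z)) + h((L_Y P)X, Z) + h(Y, (L_Z P)X)`. -/
def tachibana (X Y Z : ∀ x : M, TangentSpace 𝓘(ℝ, E) x) (p : M) : ℝ :=
  mvfderiv 𝓘(ℝ, E) (fun x ↦ h x (Y x) (Z x)) p (P.field X p)
    - mvfderiv 𝓘(ℝ, E) (fun x ↦ h x (P.field Y x) (Z x)) p (X p)
    + h p (P.lieDeriv Y X p) (Z p) + h p (Y p) (P.lieDeriv Z X p)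

/-- `(Ψ_P h)(X, Y, Z) = (φ_P h)(X, Y, Z) + (φ_P h)(Z, Y, X)`. -/
def psi (X Y Z : ∀ x : M, TangentSpace 𝓘(ℝ, E) x) (p : M) : ℝ :=
  P.tachibana h X Y Z p + P.tachibana h Z Y X p

/-- The condition `(Ψ_P h)(X, Y, Z) = (Ψ_P h)(Y, X, Z) + (Ψ_P h)(PY, PX, Z)`. -/
def StarCondition : Prop :=
  ∀ (p : M) (X Y Z : ∀ x : M, TangentSpace 𝓘(ℝ, E) x),
    SmoothFieldAt X p → SmoothFieldAt Y p → SmoothFieldAt Z p →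
      P.psi h X Y Z p = P.psi h Y X Z p + P.psi h (P.field Y) (P.field X) Z p

/-- `(∇_X P) Y = ∇_X (PY) - P (∇_X Y)`, with `∇` the Levi-Civita connection of `h`. -/
def covDeriv [FiniteDimensional ℝ E] (X Y : ∀ x : M, TangentSpace 𝓘(ℝ, E) x) (p : M) :
    TangentSpace 𝓘(ℝ, E) p :=
  h.leviCivita (P.field Y) p (X p) - P p (h.leviCivita Y p (X p))

end AlmostProductStructure

section Classes

variable (h : SemiRiemannianMetric E M) (P : AlmostProductStructure E M)

/-- An almost product Riemannian manifold: `h` is Riemannian and pure, `h(PX, Y) = h(X, PY)`. -/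
structure IsAlmostProductRiemannian : Prop where
  riemannian : h.IsRiemannian
  pure : ∀ (p : M) (v w : TangentSpace 𝓘(ℝ, E) p), h p (P p v) w = h p v (P p w)

/-- A locally decomposable product Riemannian manifold. -/
structure IsLocallyDecomposableProductRiemannian : Prop extends
    IsAlmostProductRiemannian h P where
  integrable : P.IsIntegrable
  star : P.StarCondition h

/-- An almost para-Hermitian manifold: `h` is hyperbolic, `h(PX, Y) = -h(X, PY)`. -/
structure IsAlmostParaHermitian : Prop where
  hyperbolic : ∀ (p : M) (v w : TangentSpace 𝓘(ℝ, E) p), h p (P p v) w = -h p v (P p w)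

/-- A nearly para-Kaehler manifold: almost para-Hermitian with `(∇_X P) X = 0`. -/
structure IsNearlyParaKaehler [FiniteDimensional ℝ E] : Prop extends
    IsAlmostParaHermitian h P where
  nearly : ∀ (p : M) (X : ∀ x : M, TangentSpace 𝓘(ℝ, E) x),
    SmoothFieldAt X p → P.covDeriv h X X p = 0

end Classes

section Maps

variable {E' : Type*} [NormedAddCommGroup E'] [NormedSpace ℝ E']
  {N : Type*} [TopologicalSpace N] [ChartedSpace E' N] [IsManifold 𝓘(ℝ, E') ∞ N]

/-- `F_* ∘ P = Q ∘ F_*`. -/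
def IsParaholomorphic (P : AlmostProductStructure E M) (Q : AlmostProductStructure E' N)
    (F : M → N) : Prop :=
  ∀ (p : M) (v : TangentSpace 𝓘(ℝ, E) p),
    mfderiv 𝓘(ℝ, E) 𝓘(ℝ, E') F p (P p v) = Q (F p) (mfderiv 𝓘(ℝ, E) 𝓘(ℝ, E') F p v)

/-- `F_* ∘ P = -Q ∘ F_*`. -/
def IsAntiParaholomorphic (P : AlmostProductStructure E M) (Q : AlmostProductStructure E' N)
    (F : M → N) : Prop :=
  ∀ (p : M) (v : TangentSpace 𝓘(ℝ, E) p),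
    mfderiv 𝓘(ℝ, E) 𝓘(ℝ, E') F p (P p v) = -Q (F p) (mfderiv 𝓘(ℝ, E) 𝓘(ℝ, E') F p v)

/-- The push-forward `x ↦ F_* (Y x)` of a vector field, as a vector field along `F`. -/
def pushforward (F : M → N) (Y : ∀ x : M, TangentSpace 𝓘(ℝ, E) x) (x : M) :
    TangentSpace 𝓘(ℝ, E') (F x) :=
  mfderiv 𝓘(ℝ, E) 𝓘(ℝ, E') F x (Y x)

/-- The directional derivatives at `p` of the components of a vector field `V` along `F`, in the
preferred chart at `F p`. -/
def coordDerivAlong (F : M → N) (V : ∀ x : M, TangentSpace 𝓘(ℝ, E') (F x)) (p : M) :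
    TangentSpace 𝓘(ℝ, E) p →L[ℝ] TangentSpace 𝓘(ℝ, E') (F p) :=
  mvfderiv 𝓘(ℝ, E) (fun x ↦ coords (F p) (V x)) p

variable [FiniteDimensional ℝ E'] (h : SemiRiemannianMetric E M) (g : SemiRiemannianMetric E' N)

/-- The Levi-Civita connection of `g` pulled back along `F`, i.e. the covariant derivative of a
vector field `V` along `F` in direction `u`: in the preferred chart at `F p` it is
`∂_u V + Γ_{F p}(F_* u, V(p))`. -/
def nablaAlong (F : M → N) (V : ∀ x : M, TangentSpace 𝓘(ℝ, E') (F x)) (p : M)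
    (u : TangentSpace 𝓘(ℝ, E) p) : TangentSpace 𝓘(ℝ, E') (F p) :=
  coordDerivAlong F V p u + g.christoffel (F p) (mfderiv 𝓘(ℝ, E) 𝓘(ℝ, E') F p u) (V p)

/-- Along `F`, the restriction `Y ∘ F` of a vector field `Y` on `N` has covariant derivative
`∇_{F_* u} Y`. -/
theorem nablaAlong_comp {F : M → N} {p : M} (hF : MDiffAt F p)
    {Y : ∀ y : N, TangentSpace 𝓘(ℝ, E') y} (hY : MDiffAt (T% Y) (F p))
    (u : TangentSpace 𝓘(ℝ, E) p) :
    nablaAlong g F (fun x ↦ Y (F x)) p u =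
      g.leviCivita Y (F p) (mfderiv 𝓘(ℝ, E) 𝓘(ℝ, E') F p u) := by
  rw [SemiRiemannianMetric.leviCivita_apply, nablaAlong]
  congr 1
  have hc : MDiffAt (fun y : N ↦ coords (F p) (Y y)) (F p) := mdifferentiableAt_coords hY
  have hd := mfderiv_comp (I := 𝓘(ℝ, E)) (I' := 𝓘(ℝ, E')) (I'' := 𝓘(ℝ, E'))
    (g := fun y : N ↦ coords (F p) (Y y)) (f := F) p hc hF
  exact congrArg (· u) hd

variable [FiniteDimensional ℝ E]

/-- The second fundamental form `(∇F_*)(X, Y) = ∇^N_{F_* X} (F_* Y) - F_* (∇^M_X Y)`. -/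
def secondFundamentalForm (F : M → N) (X Y : ∀ x : M, TangentSpace 𝓘(ℝ, E) x) (p : M) :
    TangentSpace 𝓘(ℝ, E') (F p) :=
  nablaAlong g F (pushforward F Y) p (X p)
    - mfderiv 𝓘(ℝ, E) 𝓘(ℝ, E') F p (h.leviCivita Y p (X p))

/-- The `D`-tension field `∑ h^{ij} (∇F_*)(e_i, e_j)` at `p`, for a basis `e` of `D p`. Since
`∇F_*` is tensorial, the extension of the `e_i` to vector fields near `p` is immaterial, and the
sum does not depend on the basis. -/
def tensionField (D : ∀ p : M, Submodule ℝ (TangentSpace 𝓘(ℝ, E) p)) (F : M → N) (p : M) :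
    TangentSpace 𝓘(ℝ, E') (F p) :=
  let e := Module.finBasis ℝ (D p)
  let H : Matrix (Fin (Module.finrank ℝ (D p))) (Fin (Module.finrank ℝ (D p))) ℝ :=
    Matrix.of fun i j ↦ h p (e i : TangentSpace 𝓘(ℝ, E) p) (e j : TangentSpace 𝓘(ℝ, E) p)
  ∑ i, ∑ j, H⁻¹ i j • secondFundamentalForm h g F
    (coordField (e i : TangentSpace 𝓘(ℝ, E) p)) (coordField (e j : TangentSpace 𝓘(ℝ, E) p)) p

/-- `F` is `D`-harmonic: its `D`-tension field vanishes. -/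
def IsDHarmonic (D : ∀ p : M, Submodule ℝ (TangentSpace 𝓘(ℝ, E) p)) (F : M → N) : Prop :=
  ∀ p : M, tensionField h g D F p = 0

/-- `F` is harmonic: its tension field vanishes. -/
def IsHarmonic (F : M → N) : Prop := IsDHarmonic h g (fun _ ↦ ⊤) F

variable (P : AlmostProductStructure E M)

/-- `F` is plus-eigen harmonic. -/
def IsPlusEigenHarmonic (F : M → N) : Prop := IsDHarmonic h g (P.eigendistribution 1) F

/-- `F` is minus-eigen harmonic. -/
def IsMinusEigenHarmonic (F : M → N) : Prop := IsDHarmonic h g (P.eigendistribution (-1)) F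

end Maps

end Geometry

end ProductGeometry

end

/-! Let B be the second fundamental form of F, and let τ, τ₊, τ₋ be its traces over TM and over the
two eigendistributions of P. As P is h-symmetric, E₍₁₎ and E₍₋₁₎ are orthogonal complements, so τ =
τ₊ + τ₋ (`gramTrace_top`, `tensionField_top`). This gives one direction; the other needs τ₊ and τ₋
to be linearly independent unless they vanish.

The independence comes from Q. Write F_* P = εQ F_* with ε = ±1. Differentiate F_*(PU) = εQ F_*U in
the direction u = U(p): P is parallel, and the derivative of Q enters only as (∇_{F_*u} Q) F_*u,
which is zero for both kinds of target. What remains is B(u, Pu) = εQ B(u, u)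
(`secondFundamentalTensor_comp`). On the c-eigenspace of P this reads εQ B(v, v) = c B(v, v).
Polarizing and contracting with the symmetric inverse Gram matrix gives εQ τ_c = c τ_c
(`map_gramTrace`). So τ₊ and τ₋ belong to the eigenvalues 1 and -1 of the same operator, and a
vanishing sum forces both to vanish.

That P is parallel must be extracted from N_P = 0 and the Ψ-condition. Expressed through A(u, v) =
(∇_u P)v, both are linear identities in A, and together they give A = 0 (`nablaTensor_eq_zero`). -/

noncomputable section

namespace ProductGeometry

/-! ### Leibniz rules in charts for fields of linear maps along two maps. -/

section Leibniz

/-- Leibniz rule for the application of a field of continuous linear maps. -/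
lemma mvfderiv_clm_apply {E : Type*} [NormedAddCommGroup E] [NormedSpace ℝ E]
    {M : Type*} [TopologicalSpace M] [ChartedSpace E M]
    {V W : Type*} [NormedAddCommGroup V] [NormedSpace ℝ V] [NormedAddCommGroup W]
    [NormedSpace ℝ W] {A : M → V →L[ℝ] W} {f : M → V} {p : M}
    (hA : MDiffAt A p) (hf : MDiffAt f p) (u : TangentSpace 𝓘(ℝ, E) p) :
    mvfderiv 𝓘(ℝ, E) (fun x ↦ A x (f x)) p u =
      mvfderiv 𝓘(ℝ, E) A p u (f p) + A p (mvfderiv 𝓘(ℝ, E) f p u) := by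
  have hbil : IsBoundedBilinearMap ℝ (fun z : (V →L[ℝ] W) × V ↦ z.1 z.2) :=
    isBoundedBilinearMap_apply
  -- The pair is differentiated by hand so that its target carries the model of the normed product
  -- space, as the Fréchet derivative of evaluation requires.
  have h1 : HasMFDerivAt 𝓘(ℝ, E) 𝓘(ℝ, (V →L[ℝ] W) × V) (fun x ↦ (A x, f x)) p
      ((mvfderiv 𝓘(ℝ, E) A p).prod (mvfderiv 𝓘(ℝ, E) f p)) :=
    ⟨hA.hasMFDerivAt.1.prodMk hf.hasMFDerivAt.1, hA.hasMFDerivAt.2.prodMk hf.hasMFDerivAt.2⟩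
  have h2 := ((hbil.hasFDerivAt (A p, f p)).hasMFDerivAt).comp p h1
  refine (congrArg (· u) h2.mfderiv).trans ?_
  change hbil.deriv (A p, f p) (mvfderiv 𝓘(ℝ, E) A p u, mvfderiv 𝓘(ℝ, E) f p u) = _
  exact add_comm (A p (mvfderiv 𝓘(ℝ, E) f p u)) _

variable {E : Type*} [NormedAddCommGroup E] [NormedSpace ℝ E]
  {M : Type*} [TopologicalSpace M] [ChartedSpace E M]
  {E₁ : Type*} [NormedAddCommGroup E₁] [NormedSpace ℝ E₁]
  {N₁ : Type*} [TopologicalSpace N₁] [ChartedSpace E₁ N₁] [IsManifold 𝓘(ℝ, E₁) ∞ N₁]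
  {E₂ : Type*} [NormedAddCommGroup E₂] [NormedSpace ℝ E₂]
  {N₂ : Type*} [TopologicalSpace N₂] [ChartedSpace E₂ N₂] [IsManifold 𝓘(ℝ, E₂) ∞ N₂]

/-- The matrix, in the preferred charts at `q₁` and `q₂`, of a linear map between tangent spaces. -/
def homCoords (q₁ : N₁) (q₂ : N₂) {y₁ : N₁} {y₂ : N₂}
    (A : TangentSpace 𝓘(ℝ, E₁) y₁ →L[ℝ] TangentSpace 𝓘(ℝ, E₂) y₂) : E₁ →L[ℝ] E₂ :=
  ContinuousLinearMap.inCoordinates E₁ (TangentSpace 𝓘(ℝ, E₁)) E₂ (TangentSpace 𝓘(ℝ, E₂))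
    q₁ y₁ q₂ y₂ A

/-- Passing to coordinates and back is the identity only over the base set of the trivialization at
`q₁`, so identities of components along a map hold only near the base point. That is enough to
differentiate them. -/
lemma homCoords_apply_coords (q₁ : N₁) (q₂ : N₂) {y₁ : N₁} {y₂ : N₂}
    (hy₁ : y₁ ∈ (trivializationAt E₁ (TangentSpace 𝓘(ℝ, E₁)) q₁).baseSet)
    (A : TangentSpace 𝓘(ℝ, E₁) y₁ →L[ℝ] TangentSpace 𝓘(ℝ, E₂) y₂)
    (v : TangentSpace 𝓘(ℝ, E₁) y₁) :
    homCoords q₁ q₂ A (coords q₁ v) = coords q₂ (A v) := by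
  simp only [homCoords, ContinuousLinearMap.inCoordinates, coords, ContinuousLinearMap.comp_apply]
  rw [Trivialization.symmL_continuousLinearMapAt _ hy₁]

lemma homCoords_self (q₁ : N₁) (q₂ : N₂)
    (A : TangentSpace 𝓘(ℝ, E₁) q₁ →L[ℝ] TangentSpace 𝓘(ℝ, E₂) q₂)
    (v : TangentSpace 𝓘(ℝ, E₁) q₁) : homCoords q₁ q₂ A v = A v := by
  have h := homCoords_apply_coords q₁ q₂ (FiberBundle.mem_baseSet_trivializationAt' q₁) A v
  rwa [coords_self, coords_self] at h

/-- The directional derivatives at `p`, in the preferred charts, of a field of linear maps between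
tangent spaces along two maps. -/
def homDerivAlong (b₁ : M → N₁) (b₂ : M → N₂)
    (A : ∀ x, TangentSpace 𝓘(ℝ, E₁) (b₁ x) →L[ℝ] TangentSpace 𝓘(ℝ, E₂) (b₂ x)) (p : M) :
    TangentSpace 𝓘(ℝ, E) p →L[ℝ]
      TangentSpace 𝓘(ℝ, E₁) (b₁ p) →L[ℝ] TangentSpace 𝓘(ℝ, E₂) (b₂ p) :=
  mvfderiv 𝓘(ℝ, E) (fun x ↦ homCoords (b₁ p) (b₂ p) (A x)) p

/-- Leibniz rule, in the preferred charts, for a field of linear maps between tangent spaces along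
two maps. -/
lemma coordDerivAlong_apply {b₁ : M → N₁} {b₂ : M → N₂} {p : M} (hb₁ : ContinuousAt b₁ p)
    (A : ∀ x, TangentSpace 𝓘(ℝ, E₁) (b₁ x) →L[ℝ] TangentSpace 𝓘(ℝ, E₂) (b₂ x))
    (V : ∀ x, TangentSpace 𝓘(ℝ, E₁) (b₁ x))
    (hA : MDiffAt (fun x ↦ homCoords (b₁ p) (b₂ p) (A x)) p)
    (hV : MDiffAt (fun x ↦ coords (b₁ p) (V x)) p) (u : TangentSpace 𝓘(ℝ, E) p) :
    coordDerivAlong b₂ (fun x ↦ A x (V x)) p u =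
      homDerivAlong b₁ b₂ A p u (V p) + A p (coordDerivAlong b₁ V p u) := by
  have he : (fun x ↦ coords (b₂ p) (A x (V x))) =ᶠ[𝓝 p]
      fun x ↦ homCoords (b₁ p) (b₂ p) (A x) (coords (b₁ p) (V x)) := by
    filter_upwards [hb₁ ((trivializationAt E₁ (TangentSpace 𝓘(ℝ, E₁)) (b₁ p)).open_baseSet.mem_nhds
      (FiberBundle.mem_baseSet_trivializationAt' (b₁ p)))] with x hx
    exact (homCoords_apply_coords _ _ hx _ _).symm
  have h := mvfderiv_clm_apply hA hV u
  rw [coords_self] at h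
  have hd : coordDerivAlong b₂ (fun x ↦ A x (V x)) p u =
      mvfderiv 𝓘(ℝ, E) (fun x ↦ homCoords (b₁ p) (b₂ p) (A x) (coords (b₁ p) (V x))) p u :=
    congrArg (· u) (he.mfderiv_eq (I := 𝓘(ℝ, E)) (I' := 𝓘(ℝ, E₂)))
  refine (hd.trans h).trans ?_
  exact congrArg (homDerivAlong b₁ b₂ A p u (V p) + ·) (homCoords_self (b₁ p) (b₂ p) (A p) (coordDerivAlong b₁ V p u))

/-- Applying a differentiable field of linear maps preserves differentiability of the components. -/
lemma mdifferentiableAt_coords_apply {b₁ : M → N₁} {b₂ : M → N₂} {p : M}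
    (hb₁ : ContinuousAt b₁ p)
    (A : ∀ x, TangentSpace 𝓘(ℝ, E₁) (b₁ x) →L[ℝ] TangentSpace 𝓘(ℝ, E₂) (b₂ x))
    (V : ∀ x, TangentSpace 𝓘(ℝ, E₁) (b₁ x))
    (hA : MDiffAt (fun x ↦ homCoords (b₁ p) (b₂ p) (A x)) p)
    (hV : MDiffAt (fun x ↦ coords (b₁ p) (V x)) p) :
    MDiffAt (fun x ↦ coords (b₂ p) (A x (V x))) p := by
  refine (hA.clm_apply hV).congr_of_eventuallyEq ?_
  filter_upwards [hb₁ ((trivializationAt E₁ (TangentSpace 𝓘(ℝ, E₁)) (b₁ p)).open_baseSet.mem_nhds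
      (FiberBundle.mem_baseSet_trivializationAt' (b₁ p)))] with x hx
  exact (homCoords_apply_coords _ _ hx _ _).symm

end Leibniz

/-! ### The covariant derivative of an almost product structure as a tensor. -/

namespace AlmostProductStructure

variable {E : Type*} [NormedAddCommGroup E] [NormedSpace ℝ E]
  {M : Type*} [TopologicalSpace M] [ChartedSpace E M] [IsManifold 𝓘(ℝ, E) ∞ M]
  (P : AlmostProductStructure E M)

/-- The directional derivatives at `q` of the matrix of `P` in the preferred chart at `q`. -/
def matrixDeriv (q : M) : TangentSpace 𝓘(ℝ, E) q →L[ℝ]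
    TangentSpace 𝓘(ℝ, E) q →L[ℝ] TangentSpace 𝓘(ℝ, E) q :=
  homDerivAlong id id (fun x ↦ P x) q

lemma mdifferentiableAt_homCoords (q : M) : MDiffAt (fun x ↦ homCoords q q (P x)) q :=
  ((contMDiffAt_hom_bundle _).1 P.contMDiff.contMDiffAt).2.mdifferentiableAt (by simp)

lemma smoothFieldAt_field {X : ∀ x : M, TangentSpace 𝓘(ℝ, E) x} {p : M}
    (hX : SmoothFieldAt X p) : SmoothFieldAt (P.field X) p :=
  ContMDiffAt.clm_bundle_apply (F₁ := E) (F₂ := E) P.contMDiff.contMDiffAt hX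

/-- The case of two identity maps. The other uses of the two-map rule are the differential of F,
along the identity and F, and Q, along F twice. -/
lemma coordDeriv_field {Y : ∀ x : M, TangentSpace 𝓘(ℝ, E) x} {p : M} (hY : MDiffAt (T% Y) p)
    (u : TangentSpace 𝓘(ℝ, E) p) :
    coordDeriv (P.field Y) p u = P.matrixDeriv p u (Y p) + P p (coordDeriv Y p u) :=
  coordDerivAlong_apply (b₁ := id) (b₂ := id) continuousAt_id (fun x ↦ P x) Y
    (P.mdifferentiableAt_homCoords p) (mdifferentiableAt_coords hY) u

variable [FiniteDimensional ℝ E] (h : SemiRiemannianMetric E M)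

/-- The tensor `(∇_u P) v`. -/
def nablaTensor (p : M) (u v : TangentSpace 𝓘(ℝ, E) p) : TangentSpace 𝓘(ℝ, E) p :=
  P.matrixDeriv p u v + (h.christoffel p u (P p v) - P p (h.christoffel p u v))

lemma covDeriv_eq_nablaTensor (X : ∀ x : M, TangentSpace 𝓘(ℝ, E) x)
    {Y : ∀ x : M, TangentSpace 𝓘(ℝ, E) x} {p : M} (hY : MDiffAt (T% Y) p) :
    P.covDeriv h X Y p = P.nablaTensor h p (X p) (Y p) := by
  rw [covDeriv, SemiRiemannianMetric.leviCivita_apply, SemiRiemannianMetric.leviCivita_apply,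
    P.coordDeriv_field hY, map_add, nablaTensor]
  simp only [field]
  abel

lemma leviCivita_field {Y : ∀ x : M, TangentSpace 𝓘(ℝ, E) x} {p : M} (hY : MDiffAt (T% Y) p)
    (u : TangentSpace 𝓘(ℝ, E) p) :
    h.leviCivita (P.field Y) p u = P.nablaTensor h p u (Y p) + P p (h.leviCivita Y p u) := by
  -- The direction field matters only through its value at `p`, so any extension of `u` will do.
  have := P.covDeriv_eq_nablaTensor h (coordField u) hY
  rw [covDeriv, coordField_self] at this
  rw [← this, sub_add_cancel]

end AlmostProductStructure

/-! ### The second fundamental form as a bilinear map, and derivatives along F. -/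

section SecondFundamentalForm

variable {E : Type*} [NormedAddCommGroup E] [NormedSpace ℝ E]
  {M : Type*} [TopologicalSpace M] [ChartedSpace E M] [IsManifold 𝓘(ℝ, E) ∞ M]
  {E' : Type*} [NormedAddCommGroup E'] [NormedSpace ℝ E']
  {N : Type*} [TopologicalSpace N] [ChartedSpace E' N] [IsManifold 𝓘(ℝ, E') ∞ N]

lemma mdifferentiableAt_homCoords_mfderiv {F : M → N} (hF : ContMDiff 𝓘(ℝ, E) 𝓘(ℝ, E') ∞ F)
    (p : M) : MDiffAt (fun x ↦ homCoords p (F p) (mfderiv 𝓘(ℝ, E) 𝓘(ℝ, E') F x)) p :=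
  (ContMDiffAt.mfderiv_const (m := ∞) (hF.contMDiffAt (x := p)) (by simp)).mdifferentiableAt
    (by simp)

/-- The directional derivatives at `p` of the Jacobian of `F` in the preferred charts. -/
def jacobianDeriv (F : M → N) (p : M) : TangentSpace 𝓘(ℝ, E) p →L[ℝ]
    TangentSpace 𝓘(ℝ, E) p →L[ℝ] TangentSpace 𝓘(ℝ, E') (F p) :=
  homDerivAlong id F (fun x ↦ mfderiv 𝓘(ℝ, E) 𝓘(ℝ, E') F x) p

lemma coordDerivAlong_pushforward {F : M → N} (hF : ContMDiff 𝓘(ℝ, E) 𝓘(ℝ, E') ∞ F)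
    {Y : ∀ x : M, TangentSpace 𝓘(ℝ, E) x} {p : M} (hY : MDiffAt (T% Y) p)
    (u : TangentSpace 𝓘(ℝ, E) p) :
    coordDerivAlong F (pushforward F Y) p u =
      jacobianDeriv F p u (Y p) + mfderiv 𝓘(ℝ, E) 𝓘(ℝ, E') F p (coordDeriv Y p u) :=
  coordDerivAlong_apply (b₁ := id) (b₂ := F) continuousAt_id
    (fun x ↦ mfderiv 𝓘(ℝ, E) 𝓘(ℝ, E') F x) Y
    (mdifferentiableAt_homCoords_mfderiv hF p) (mdifferentiableAt_coords hY) u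

lemma mdifferentiableAt_coords_pushforward {F : M → N} (hF : ContMDiff 𝓘(ℝ, E) 𝓘(ℝ, E') ∞ F)
    {Y : ∀ x : M, TangentSpace 𝓘(ℝ, E) x} {p : M} (hY : MDiffAt (T% Y) p) :
    MDiffAt (fun x ↦ coords (F p) (pushforward (E' := E') F Y x)) p :=
  mdifferentiableAt_coords_apply (b₁ := id) (b₂ := F) continuousAt_id
    (fun x ↦ mfderiv 𝓘(ℝ, E) 𝓘(ℝ, E') F x) Y
    (mdifferentiableAt_homCoords_mfderiv hF p) (mdifferentiableAt_coords hY)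

variable [FiniteDimensional ℝ E] [FiniteDimensional ℝ E']
  (h : SemiRiemannianMetric E M) (g : SemiRiemannianMetric E' N)

/-- The second fundamental form as a bilinear form on the tangent space. -/
def secondFundamentalTensor (F : M → N) (p : M) :
    TangentSpace 𝓘(ℝ, E) p →ₗ[ℝ] TangentSpace 𝓘(ℝ, E) p →ₗ[ℝ] TangentSpace 𝓘(ℝ, E') (F p) :=
  LinearMap.mk₂ ℝ
    (fun u v ↦ jacobianDeriv F p u v +
      g.christoffel (F p) (mfderiv 𝓘(ℝ, E) 𝓘(ℝ, E') F p u) (mfderiv 𝓘(ℝ, E) 𝓘(ℝ, E') F p v) -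
      mfderiv 𝓘(ℝ, E) 𝓘(ℝ, E') F p (h.christoffel p u v))
    (fun u u' v ↦ by
      simp only [map_add, add_apply, LinearMap.add_apply]
      abel)
    (fun c u v ↦ by
      simp only [map_smul, smul_apply, LinearMap.smul_apply, smul_add, smul_sub])
    (fun u v v' ↦ by
      simp only [map_add]
      abel)
    (fun c u v ↦ by
      simp only [map_smul, smul_add, smul_sub])

/-- The second fundamental form is tensorial. -/
lemma secondFundamentalForm_eq {F : M → N} (hF : ContMDiff 𝓘(ℝ, E) 𝓘(ℝ, E') ∞ F)
    (X : ∀ x : M, TangentSpace 𝓘(ℝ, E) x)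
    {Y : ∀ x : M, TangentSpace 𝓘(ℝ, E) x} {p : M} (hY : MDiffAt (T% Y) p) :
    secondFundamentalForm h g F X Y p = secondFundamentalTensor h g F p (X p) (Y p) := by
  rw [secondFundamentalForm, nablaAlong, coordDerivAlong_pushforward hF hY,
    SemiRiemannianMetric.leviCivita_apply, map_add]
  simp only [pushforward, secondFundamentalTensor, LinearMap.mk₂_apply]
  abel

omit [IsManifold 𝓘(ℝ, E) ∞ M] [FiniteDimensional ℝ E] in
/-- Leibniz rule for an almost product structure applied to a vector field along a map. -/
lemma nablaAlong_apply (Q : AlmostProductStructure E' N) {F : M → N} {p : M} (hF : MDiffAt F p)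
    (V : ∀ x : M, TangentSpace 𝓘(ℝ, E') (F x)) (hV : MDiffAt (fun x ↦ coords (F p) (V x)) p)
    (u : TangentSpace 𝓘(ℝ, E) p) :
    nablaAlong g F (fun x ↦ Q (F x) (V x)) p u =
      Q.nablaTensor g (F p) (mfderiv 𝓘(ℝ, E) 𝓘(ℝ, E') F p u) (V p) +
        Q (F p) (nablaAlong g F V p u) := by
  have hA := (Q.mdifferentiableAt_homCoords (F p)).comp p hF
  have h1 : coordDerivAlong F (fun x ↦ Q (F x) (V x)) p u =
      Q.matrixDeriv (F p) (mfderiv 𝓘(ℝ, E) 𝓘(ℝ, E') F p u) (V p) +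
        Q (F p) (coordDerivAlong F V p u) := by
    refine (coordDerivAlong_apply (b₁ := F) (b₂ := F) hF.continuousAt (fun x ↦ Q (F x)) V hA hV
      u).trans ?_
    have h2 := mfderiv_comp_apply (I := 𝓘(ℝ, E)) (I' := 𝓘(ℝ, E'))
      (I'' := 𝓘(ℝ, E' →L[ℝ] E')) p (Q.mdifferentiableAt_homCoords (F p)) hF u
    exact congrArg (fun B : TangentSpace 𝓘(ℝ, E') (F p) →L[ℝ] TangentSpace 𝓘(ℝ, E') (F p) ↦ B (V p) + Q (F p) (coordDerivAlong F V p u)) h2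
  simp only [nablaAlong]
  rw [h1, AlmostProductStructure.nablaTensor, map_add]
  abel

end SecondFundamentalForm

/-! ### Integrability and the Ψ-condition make P parallel. -/

namespace AlmostProductStructure

variable {E : Type*} [NormedAddCommGroup E] [NormedSpace ℝ E]
  {M : Type*} [TopologicalSpace M] [ChartedSpace E M] [IsManifold 𝓘(ℝ, E) ∞ M]
  (P : AlmostProductStructure E M)

lemma field_field (X : ∀ x : M, TangentSpace 𝓘(ℝ, E) x) : P.field (P.field X) = X :=
  funext fun x ↦ P.sq x (X x)

lemma val_injective (p : M) : Function.Injective (P p) :=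
  (show Function.LeftInverse (P p) (P p) from P.sq p).injective

variable [FiniteDimensional ℝ E] (h : SemiRiemannianMetric E M)

/-- Differentiate P² = I. -/
lemma nablaTensor_comp (p : M) (u v : TangentSpace 𝓘(ℝ, E) p) :
    P.nablaTensor h p u (P p v) = -P p (P.nablaTensor h p u v) := by
  have hs : SmoothFieldAt (coordField v) p := contMDiffAt_coordField v
  have h1 := P.leviCivita_field h ((P.smoothFieldAt_field hs).mdifferentiableAt (by simp)) u
  rw [P.field_field, P.leviCivita_field h (hs.mdifferentiableAt (by simp)), map_add, P.sq, field,
    coordField_self] at h1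
  linear_combination (norm := module) -h1

variable {P h}

/-- Differentiate h(PY, Z) = h(Y, PZ), using that the connection is metric. -/
lemma nablaTensor_symm (hP : IsAlmostProductRiemannian h P) (p : M)
    (u v w : TangentSpace 𝓘(ℝ, E) p) :
    h p (P.nablaTensor h p u v) w = h p v (P.nablaTensor h p u w) := by
  have hs (v : TangentSpace 𝓘(ℝ, E) p) : SmoothFieldAt (coordField v) p := contMDiffAt_coordField v
  have hd (v : TangentSpace 𝓘(ℝ, E) p) := (hs v).mdifferentiableAt (by simp)
  have hPd (v : TangentSpace 𝓘(ℝ, E) p) :=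
    (P.smoothFieldAt_field (hs v)).mdifferentiableAt (by simp)
  have h1 := h.leviCivita_metric (hPd v) (hd w) u
  have h2 := h.leviCivita_metric (hd v) (hPd w) u
  simp only [P.leviCivita_field h (hd _), map_add, add_apply] at h1 h2
  simp only [field, hP.pure, coordField_self] at h1 h2
  linarith

/-- Brackets become covariant derivatives because the torsion vanishes. By metricity and purity all
derivatives of X, Y, Z cancel, and only derivatives of P survive. -/
lemma tachibana_eq (hP : IsAlmostProductRiemannian h P) {p : M}
    {X Y Z : ∀ x : M, TangentSpace 𝓘(ℝ, E) x} (hX : SmoothFieldAt X p) (hY : SmoothFieldAt Y p)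
    (hZ : SmoothFieldAt Z p) :
    P.tachibana h X Y Z p = -h p (P.nablaTensor h p (X p) (Y p)) (Z p)
      + h p (P.nablaTensor h p (Y p) (X p)) (Z p) + h p (Y p) (P.nablaTensor h p (Z p) (X p)) := by
  have hXd := hX.mdifferentiableAt (by simp)
  have hYd := hY.mdifferentiableAt (by simp)
  have hZd := hZ.mdifferentiableAt (by simp)
  have hPX := (P.smoothFieldAt_field hX).mdifferentiableAt (by simp)
  have hPY := (P.smoothFieldAt_field hY).mdifferentiableAt (by simp)
  rw [tachibana, lieDeriv, lieDeriv, h.leviCivita_metric hYd hZd, h.leviCivita_metric hPY hZd,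
    ← h.leviCivita_torsionFree hYd hPX, ← h.leviCivita_torsionFree hYd hXd,
    ← h.leviCivita_torsionFree hZd hPX, ← h.leviCivita_torsionFree hZd hXd,
    P.leviCivita_field h hYd, P.leviCivita_field h hXd, P.leviCivita_field h hXd]
  simp only [map_add, map_sub, add_apply, sub_apply, field, hP.pure]
  ring

/-- Exchanging X and Z and adding cancels, by the symmetry of each ∇_u P, the terms differentiating
P along X and Z. -/
lemma psi_eq (hP : IsAlmostProductRiemannian h P) {p : M}
    {X Y Z : ∀ x : M, TangentSpace 𝓘(ℝ, E) x} (hX : SmoothFieldAt X p) (hY : SmoothFieldAt Y p)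
    (hZ : SmoothFieldAt Z p) :
    P.psi h X Y Z p = 2 * h p (P.nablaTensor h p (Y p) (X p)) (Z p) := by
  rw [psi, tachibana_eq hP hX hY hZ, tachibana_eq hP hZ hY hX, nablaTensor_symm hP p (X p) (Y p),
    nablaTensor_symm hP p (Z p) (Y p), nablaTensor_symm hP p (Y p) (Z p) (X p), h.symm p (Z p)]
  ring

lemma nijenhuis_eq {p : M} {X Y : ∀ x : M, TangentSpace 𝓘(ℝ, E) x} (hX : SmoothFieldAt X p)
    (hY : SmoothFieldAt Y p) :
    P.nijenhuis X Y p =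
      P.nablaTensor h p (P p (X p)) (Y p) - P.nablaTensor h p (P p (Y p)) (X p)
        + P p (P.nablaTensor h p (Y p) (X p)) - P p (P.nablaTensor h p (X p) (Y p)) := by
  have hXd := hX.mdifferentiableAt (by simp)
  have hYd := hY.mdifferentiableAt (by simp)
  have hPX := (P.smoothFieldAt_field hX).mdifferentiableAt (by simp)
  have hPY := (P.smoothFieldAt_field hY).mdifferentiableAt (by simp)
  rw [nijenhuis, ← h.leviCivita_torsionFree hXd hYd, ← h.leviCivita_torsionFree hPX hPY,
    ← h.leviCivita_torsionFree hPX hYd, ← h.leviCivita_torsionFree hXd hPY]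
  simp only [P.leviCivita_field h hXd, P.leviCivita_field h hYd, map_add, map_sub, P.sq, field]
  abel

/-- A locally decomposable product structure is parallel. -/
theorem nablaTensor_eq_zero (hP : IsLocallyDecomposableProductRiemannian h P) (p : M)
    (u v : TangentSpace 𝓘(ℝ, E) p) : P.nablaTensor h p u v = 0 := by
  have hs (v : TangentSpace 𝓘(ℝ, E) p) : SmoothFieldAt (coordField v) p := contMDiffAt_coordField v
  -- With A(u, v) = (∇_u P)v, the last term of the Ψ-condition is A(Pu, Pv), which equals -P A(Pu,
  -- v) since ∇_u P anticommutes with P.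
  have star (u v : TangentSpace 𝓘(ℝ, E) p) : P.nablaTensor h p v u =
      P.nablaTensor h p u v - P p (P.nablaTensor h p (P p u) v) := by
    refine sub_eq_zero.mp (h.nondegenerate p _ fun w ↦ ?_)
    have h1 := hP.star p _ _ _ (hs u) (hs v) (hs w)
    have hA := hP.toIsAlmostProductRiemannian
    rw [psi_eq hA (hs u) (hs v) (hs w), psi_eq hA (hs v) (hs u) (hs w),
      psi_eq hA (P.smoothFieldAt_field (hs v)) (P.smoothFieldAt_field (hs u)) (hs w)] at h1
    simp only [field, coordField_self, nablaTensor_comp, map_neg, neg_apply] at h1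
    simp only [map_sub, sub_apply]
    linarith
  have anti (u v : TangentSpace 𝓘(ℝ, E) p) :
      P.nablaTensor h p (P p u) v = -P.nablaTensor h p (P p v) u := by
    apply P.val_injective p
    rw [map_neg]
    linear_combination (norm := module) star u v + star v u
  have zero (u v : TangentSpace 𝓘(ℝ, E) p) : P.nablaTensor h p (P p u) v = 0 := by
    -- N_P(v, u) = A(Pv, u) - A(Pu, v) + P A(u, v) - P A(v, u), while P applied to `star v u` gives
    -- P A(u, v) - P A(v, u) = -A(Pv, u). Only -A(Pu, v) is left.
    have h1 := hP.integrable p _ _ (hs v) (hs u)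
    rw [nijenhuis_eq (h := h) (hs v) (hs u), coordField_self, coordField_self] at h1
    have h2 := congrArg (P p) (star v u)
    rw [map_sub, P.sq] at h2
    linear_combination (norm := module) -h1 + h2
  -- Since P² = I, every vector has the form Pu.
  have := zero (P p u) v
  rwa [P.sq] at this

end AlmostProductStructure

/-! ### Traces over subspaces in arbitrary bases. -/

section Trace

open Module

variable {V W : Type*} [AddCommGroup V] [Module ℝ V] [AddCommGroup W] [Module ℝ W]
  {β : LinearMap.BilinForm ℝ V}

/-- The Gram matrix of `β` in a basis of a subspace. -/
def gram (β : LinearMap.BilinForm ℝ V) {D : Submodule ℝ V} {ι : Type*} (e : Basis ι ℝ D) :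
    Matrix ι ι ℝ := Matrix.of fun i j ↦ β (e i) (e j)

/-- The contraction of `B` with the inverse Gram matrix of `β` in a basis of a subspace. -/
def gramTrace (β : LinearMap.BilinForm ℝ V) (B : V →ₗ[ℝ] V →ₗ[ℝ] W) {D : Submodule ℝ V}
    {ι : Type*} [Fintype ι] [DecidableEq ι] (e : Basis ι ℝ D) : W :=
  ∑ i, ∑ j, (gram β e)⁻¹ i j • B (e i) (e j)

variable {D : Submodule ℝ V} {ι : Type*} [Fintype ι] [DecidableEq ι]

/-- A kernel vector c of the Gram matrix gives v = ∑ cᵢeᵢ with β(v, v) = 0. Definiteness is what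
makes this work on every subspace. -/
lemma isUnit_det_gram (hpos : ∀ v, v ≠ 0 → 0 < β v v) (e : Basis ι ℝ D) :
    IsUnit (gram β e).det := by
  rw [isUnit_iff_ne_zero]
  intro h0
  obtain ⟨c, hc, hc0⟩ := Matrix.exists_mulVec_eq_zero_iff.mpr h0
  have hv : (∑ i, c i • e i) ≠ 0 := fun h ↦
    hc (funext (Fintype.linearIndependent_iff.mp e.linearIndependent c h))
  have := hpos (∑ i, c i • e i : D) (by simpa only [ne_eq, ZeroMemClass.coe_eq_zero] using hv)
  refine this.ne' ?_
  have h1 (i : ι) : ∑ j, β (e i) (e j) * c j = 0 := congrFun hc0 i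
  simp only [Submodule.coe_sum, Submodule.coe_smul, map_sum, map_smul, LinearMap.sum_apply,
    LinearMap.smul_apply, smul_eq_mul, Finset.mul_sum]
  rw [Finset.sum_comm]
  refine Finset.sum_eq_zero fun i _ ↦ ?_
  calc _ = c i * ∑ j, β (e i) (e j) * c j := by
        rw [Finset.mul_sum]; exact Finset.sum_congr rfl fun j _ ↦ by ring
    _ = 0 := by rw [h1, mul_zero]

lemma gram_inv_symm (hsymm : ∀ v w, β v w = β w v) (e : Basis ι ℝ D) (i j : ι) :
    (gram β e)⁻¹ i j = (gram β e)⁻¹ j i := by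
  have h : (gram β e).transpose = gram β e := by
    ext i j
    exact hsymm _ _
  conv_lhs => rw [← h, ← Matrix.transpose_nonsing_inv]
  rfl

/-- Expansion of a vector of the subspace in terms of its inner products with the basis. -/
lemma sum_gram_inv_smul (hpos : ∀ v, v ≠ 0 → 0 < β v v) (e : Basis ι ℝ D) {v : V} (hv : v ∈ D) :
    ∑ i, ∑ j, ((gram β e)⁻¹ i j * β v (e i)) • (e j : V) = v := by
  -- The right-hand side is linear in `v`, so it suffices to compare on the basis, where it is the
  -- identity G G⁻¹ = 1.
  let R : D →ₗ[ℝ] V := ∑ i, ∑ j, ((gram β e)⁻¹ i j • (β.flip (e i)).comp D.subtype).smulRight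
    (e j : V)
  have hR : R = D.subtype := by
    refine e.ext fun k ↦ ?_
    have h1 (j : ι) : ∑ i, (gram β e)⁻¹ i j * β (e k) (e i) = (1 : Matrix ι ι ℝ) k j := by
      rw [← Matrix.mul_nonsing_inv _ (isUnit_det_gram hpos e), Matrix.mul_apply]
      exact Finset.sum_congr rfl fun i _ ↦ mul_comm _ _
    simp only [R, LinearMap.sum_apply, LinearMap.smulRight_apply, LinearMap.smul_apply,
      LinearMap.comp_apply, LinearMap.BilinForm.flip_apply, Submodule.subtype_apply, smul_eq_mul]
    rw [Finset.sum_comm]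
    simp only [← Finset.sum_smul, h1, Matrix.one_apply, ite_smul, one_smul, zero_smul,
      Finset.sum_ite_eq, Finset.mem_univ, if_true]
  have := LinearMap.congr_fun hR ⟨v, hv⟩
  simpa [R] using this

variable {D₁ D₂ : Submodule ℝ V} {ι₁ ι₂ : Type*} [Fintype ι₁] [DecidableEq ι₁]
  [Fintype ι₂] [DecidableEq ι₂]

/-- The inner sum is the orthogonal projection of `e j` to D₁. Hence tracing B(·, π·) over the whole
space is tracing B over D₁: expand each `f a` in the basis `e` and exchange sums. -/
lemma gramTrace_project (hsymm : ∀ v w, β v w = β w v) (hpos : ∀ v, v ≠ 0 → 0 < β v v)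
    (B : V →ₗ[ℝ] V →ₗ[ℝ] W) (e : Basis ι ℝ (⊤ : Submodule ℝ V)) (f : Basis ι₁ ℝ D₁) :
    ∑ i, ∑ j, (gram β e)⁻¹ i j •
      B (e i) (∑ a, ∑ b, ((gram β f)⁻¹ a b * β (e j) (f a)) • (f b : V)) = gramTrace β B f := by
  have h1 (a : ι₁) : (f a : V) = ∑ i, ∑ j, ((gram β e)⁻¹ i j * β (e j) (f a)) • (e i : V) := by
    conv_lhs => rw [← sum_gram_inv_smul hpos e (Submodule.mem_top (x := (f a : V)))]
    rw [Finset.sum_comm]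
    refine Finset.sum_congr rfl fun i _ ↦ Finset.sum_congr rfl fun j _ ↦ ?_
    rw [gram_inv_symm hsymm e j i, hsymm (f a)]
  have key (t : ι → ι → ι₁ → ι₁ → W) :
      ∑ i, ∑ j, ∑ a, ∑ b, t i j a b = ∑ a, ∑ b, ∑ i, ∑ j, t i j a b := by
    calc _ = ∑ i, ∑ a, ∑ j, ∑ b, t i j a b := Finset.sum_congr rfl fun i _ ↦ Finset.sum_comm
      _ = ∑ a, ∑ i, ∑ j, ∑ b, t i j a b := Finset.sum_comm
      _ = ∑ a, ∑ i, ∑ b, ∑ j, t i j a b := Finset.sum_congr rfl fun a _ ↦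
        Finset.sum_congr rfl fun i _ ↦ Finset.sum_comm
      _ = _ := Finset.sum_congr rfl fun a _ ↦ Finset.sum_comm
  have h2 : gramTrace β B f = ∑ a, ∑ b, (gram β f)⁻¹ a b •
      B (∑ i, ∑ j, ((gram β e)⁻¹ i j * β (e j) (f a)) • (e i : V)) (f b) := by
    simp only [gramTrace, ← h1]
  rw [h2]
  simp only [map_sum, map_smul, LinearMap.sum_apply, LinearMap.smul_apply, Finset.smul_sum,
    smul_smul]
  rw [key]
  refine Finset.sum_congr rfl fun a _ ↦ Finset.sum_congr rfl fun b _ ↦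
    Finset.sum_congr rfl fun i _ ↦ Finset.sum_congr rfl fun j _ ↦ ?_
  congr 1
  ring

/-- The contraction is additive with respect to orthogonal decompositions. -/
lemma gramTrace_top (hsymm : ∀ v w, β v w = β w v) (hpos : ∀ v, v ≠ 0 → 0 < β v v)
    (hsum : ∀ v, ∃ v₁ ∈ D₁, ∃ v₂ ∈ D₂, v = v₁ + v₂)
    (horth : ∀ v₁ ∈ D₁, ∀ v₂ ∈ D₂, β v₁ v₂ = 0)
    (B : V →ₗ[ℝ] V →ₗ[ℝ] W) (e : Basis ι ℝ (⊤ : Submodule ℝ V)) (f₁ : Basis ι₁ ℝ D₁)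
    (f₂ : Basis ι₂ ℝ D₂) :
    gramTrace β B e = gramTrace β B f₁ + gramTrace β B f₂ := by
  have hdec (v : V) : v = ∑ a, ∑ b, ((gram β f₁)⁻¹ a b * β v (f₁ a)) • (f₁ b : V) +
      ∑ a, ∑ b, ((gram β f₂)⁻¹ a b * β v (f₂ a)) • (f₂ b : V) := by
    obtain ⟨v₁, hv₁, v₂, hv₂, rfl⟩ := hsum v
    have h1 (a : ι₁) : β (v₁ + v₂) (f₁ a) = β v₁ (f₁ a) := by
      rw [map_add, LinearMap.add_apply, hsymm v₂, horth _ (f₁ a).2 _ hv₂, add_zero]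
    have h2 (a : ι₂) : β (v₁ + v₂) (f₂ a) = β v₂ (f₂ a) := by
      rw [map_add, LinearMap.add_apply, horth _ hv₁ _ (f₂ a).2, zero_add]
    simp only [h1, h2, sum_gram_inv_smul hpos f₁ hv₁, sum_gram_inv_smul hpos f₂ hv₂]
  rw [← gramTrace_project hsymm hpos B e f₁, ← gramTrace_project hsymm hpos B e f₂, gramTrace,
    ← Finset.sum_add_distrib]
  refine Finset.sum_congr rfl fun i _ ↦ ?_
  rw [← Finset.sum_add_distrib]
  refine Finset.sum_congr rfl fun j _ ↦ ?_
  rw [← smul_add, ← map_add, ← hdec]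

/-- A linear relation satisfied by the polarization of `B` on a subspace passes to the
contraction. -/
lemma map_gramTrace (hsymm : ∀ v w, β v w = β w v) (B : V →ₗ[ℝ] V →ₗ[ℝ] W) (e : Basis ι ℝ D)
    (T : W →ₗ[ℝ] W) (c : ℝ) (hB : ∀ v ∈ D, T (B v v) = c • B v v) :
    T (gramTrace β B e) = c • gramTrace β B e := by
  -- B is not assumed symmetric, so polarization controls only B(v, w) + B(w, v). The contraction
  -- sees nothing else, as the inverse Gram matrix is symmetric.
  have hpol (v w : V) (hv : v ∈ D) (hw : w ∈ D) :
      T (B v w + B w v) = c • (B v w + B w v) := by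
    have h1 := hB (v + w) (D.add_mem hv hw)
    have h2 := hB v hv
    have h3 := hB w hw
    simp only [map_add, LinearMap.add_apply, smul_add] at h1 ⊢
    linear_combination (norm := module) h1 - h2 - h3
  have htwo : (2 : ℝ) • gramTrace β B e =
      ∑ i, ∑ j, (gram β e)⁻¹ i j • (B (e i) (e j) + B (e j) (e i)) := by
    have : gramTrace β B e = ∑ i, ∑ j, (gram β e)⁻¹ i j • B (e j) (e i) := by
      rw [gramTrace, Finset.sum_comm]
      refine Finset.sum_congr rfl fun i _ ↦ Finset.sum_congr rfl fun j _ ↦ ?_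
      rw [gram_inv_symm hsymm e j i]
    simp only [smul_add, Finset.sum_add_distrib]
    rw [← this, two_smul]
    rfl
  have h2 : T ((2 : ℝ) • gramTrace β B e) = c • (2 : ℝ) • gramTrace β B e := by
    simp only [htwo, map_sum, map_smul, Finset.smul_sum]
    refine Finset.sum_congr rfl fun i _ ↦ Finset.sum_congr rfl fun j _ ↦ ?_
    rw [hpol _ _ (e i).2 (e j).2, smul_comm]
  rw [map_smul, smul_comm] at h2
  exact smul_right_injective W (two_ne_zero (α := ℝ)) h2

end Trace

/-! ### The tension fields along the eigendistributions. -/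

variable {E : Type*} [NormedAddCommGroup E] [NormedSpace ℝ E] [FiniteDimensional ℝ E]
  {M : Type*} [TopologicalSpace M] [ChartedSpace E M] [IsManifold 𝓘(ℝ, E) ∞ M]
  {E' : Type*} [NormedAddCommGroup E'] [NormedSpace ℝ E'] [FiniteDimensional ℝ E']
  {N : Type*} [TopologicalSpace N] [ChartedSpace E' N] [IsManifold 𝓘(ℝ, E') ∞ N]
  {h : SemiRiemannianMetric E M} {P : AlmostProductStructure E M}
  {g : SemiRiemannianMetric E' N} {Q : AlmostProductStructure E' N} {F : M → N}

lemma IsNearlyParaKaehler.nablaTensor_self (hN : IsNearlyParaKaehler g Q) (q : N)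
    (v : TangentSpace 𝓘(ℝ, E') q) : Q.nablaTensor g q v v = 0 := by
  have hs : SmoothFieldAt (coordField v) q := contMDiffAt_coordField v
  have := hN.nearly q _ hs
  rwa [Q.covDeriv_eq_nablaTensor g _ (hs.mdifferentiableAt (by simp)), coordField_self] at this

omit [IsManifold 𝓘(ℝ, E) ∞ M] [FiniteDimensional ℝ E] in
lemma nablaAlong_const_smul {p : M} (c : ℝ) (V : ∀ x : M, TangentSpace 𝓘(ℝ, E') (F x))
    (hV : MDiffAt (fun x ↦ coords (F p) (V x)) p) (u : TangentSpace 𝓘(ℝ, E) p) :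
    nablaAlong g F (fun x ↦ c • V x) p u = c • nablaAlong g F V p u := by
  have h1 := congrArg (· u) (mvfderiv_smul (mdifferentiableAt_const (I := 𝓘(ℝ, E)) (c := c)) hV)
  rw [mvfderiv_const] at h1
  have h2 : coordDerivAlong F (fun x ↦ c • V x) p u = c • coordDerivAlong F V p u := by
    have h3 : coordDerivAlong F (fun x ↦ c • V x) p u =
        mvfderiv 𝓘(ℝ, E) (fun x ↦ c • coords (F p) (V x)) p u := by
      simp only [coordDerivAlong, coords, map_smul]
      rfl
    refine h3.trans (h1.trans ?_)
    simp
    rfl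
  simp only [nablaAlong, h2, map_smul, smul_add]

/-- The second fundamental form of a map intertwining a parallel almost product structure `P` with a
multiple of an almost product structure `Q` satisfying `(∇_v Q) v = 0`. -/
lemma secondFundamentalTensor_comp (hF : ContMDiff 𝓘(ℝ, E) 𝓘(ℝ, E') ∞ F)
    (hP : ∀ (p : M) (u v : TangentSpace 𝓘(ℝ, E) p), P.nablaTensor h p u v = 0)
    (hQ : ∀ (q : N) (v : TangentSpace 𝓘(ℝ, E') q), Q.nablaTensor g q v v = 0) {ε : ℝ}
    (hPQ : ∀ (p : M) (v : TangentSpace 𝓘(ℝ, E) p),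
      mfderiv 𝓘(ℝ, E) 𝓘(ℝ, E') F p (P p v) = ε • Q (F p) (mfderiv 𝓘(ℝ, E) 𝓘(ℝ, E') F p v))
    (p : M) (u : TangentSpace 𝓘(ℝ, E) p) :
    secondFundamentalTensor h g F p u (P p u) =
      ε • Q (F p) (secondFundamentalTensor h g F p u u) := by
  have hs : SmoothFieldAt (coordField u) p := contMDiffAt_coordField u
  have hd := hs.mdifferentiableAt (by simp)
  have hFd : MDiffAt F p := (hF p).mdifferentiableAt (by simp)
  have hV := mdifferentiableAt_coords_pushforward hF hd
  have hQV := mdifferentiableAt_coords_apply hFd.continuousAt (fun x ↦ Q (F x)) _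
    ((Q.mdifferentiableAt_homCoords (F p)).comp p hFd) hV
  have h1 := secondFundamentalForm_eq h g hF (coordField u) hd
  have h2 := secondFundamentalForm_eq h g hF (coordField u)
    ((P.smoothFieldAt_field hs).mdifferentiableAt (by simp))
  -- The intertwining relation holds at every point, so it is an identity of fields along F and may
  -- be differentiated at `p`.
  have h3 : pushforward (E' := E') F (P.field (coordField u)) =
      fun x ↦ ε • Q (F x) (pushforward (E' := E') F (coordField u) x) :=
    funext fun x ↦ hPQ x _
  rw [secondFundamentalForm, h3, nablaAlong_const_smul ε _ hQV, nablaAlong_apply g Q hFd _ hV,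
    P.leviCivita_field h hd, hP, zero_add, hPQ] at h2
  rw [secondFundamentalForm] at h1
  simp only [AlmostProductStructure.field, pushforward, coordField_self, hQ, zero_add] at h1 h2
  rw [← h1, ← h2, map_sub, smul_sub]

lemma tensionField_eq_gramTrace (hF : ContMDiff 𝓘(ℝ, E) 𝓘(ℝ, E') ∞ F)
    (D : ∀ p : M, Submodule ℝ (TangentSpace 𝓘(ℝ, E) p)) (p : M) :
    tensionField h g D F p = gramTrace (h.bilin p) (secondFundamentalTensor h g F p)
      (Module.finBasis ℝ (D p)) := by
  have hB (u v : TangentSpace 𝓘(ℝ, E) p) :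
      secondFundamentalForm h g F (coordField u) (coordField v) p =
        secondFundamentalTensor h g F p u v := by
    rw [secondFundamentalForm_eq h g hF _ ((contMDiffAt_coordField v).mdifferentiableAt (by simp)),
      coordField_self, coordField_self]
  simp only [tensionField, gramTrace, hB]
  rfl

/-- The tension field of a map from an almost product Riemannian manifold is the sum of its tension
fields along the eigendistributions. -/
lemma tensionField_top (hF : ContMDiff 𝓘(ℝ, E) 𝓘(ℝ, E') ∞ F)
    (hM : IsAlmostProductRiemannian h P) (p : M) :
    tensionField h g (fun _ ↦ ⊤) F p = tensionField h g (P.eigendistribution 1) F p +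
      tensionField h g (P.eigendistribution (-1)) F p := by
  simp only [tensionField_eq_gramTrace hF]
  refine gramTrace_top (h.symm p) (hM.riemannian p) (fun v ↦ ?_) (fun v hv w hw ↦ ?_) _ _ _ _
  -- The eigenprojections of P are (I ± P)/2.
  · refine ⟨(2⁻¹ : ℝ) • (v + P p v), ?_, (2⁻¹ : ℝ) • (v - P p v), ?_, by module⟩
    · refine Module.End.mem_eigenspace_iff.mpr ?_
      change P p _ = _
      rw [map_smul, map_add, P.sq]
      module
    · refine Module.End.mem_eigenspace_iff.mpr ?_
      change P p _ = _
      rw [map_smul, map_sub, P.sq]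
      module
  · have hv' : P p v = (1 : ℝ) • v := Module.End.mem_eigenspace_iff.mp hv
    have hw' : P p w = (-1 : ℝ) • w := Module.End.mem_eigenspace_iff.mp hw
    -- Purity reads h(v, w) = -h(v, w) for eigenvectors of opposite sign.
    have := hM.pure p v w
    rw [hv', hw', map_smul, map_smul, one_smul, smul_eq_mul] at this
    change h p v w = 0
    linarith

/-- The tension field along an eigendistribution of `P` is an eigenvector of `± Q`. -/
lemma smul_apply_tensionField_eigendistribution (hF : ContMDiff 𝓘(ℝ, E) 𝓘(ℝ, E') ∞ F)
    (hP : ∀ (p : M) (u v : TangentSpace 𝓘(ℝ, E) p), P.nablaTensor h p u v = 0)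
    (hQ : ∀ (q : N) (v : TangentSpace 𝓘(ℝ, E') q), Q.nablaTensor g q v v = 0) {ε : ℝ}
    (hPQ : ∀ (p : M) (v : TangentSpace 𝓘(ℝ, E) p),
      mfderiv 𝓘(ℝ, E) 𝓘(ℝ, E') F p (P p v) = ε • Q (F p) (mfderiv 𝓘(ℝ, E) 𝓘(ℝ, E') F p v))
    (c : ℝ) (p : M) :
    ε • Q (F p) (tensionField h g (P.eigendistribution c) F p) =
      c • tensionField h g (P.eigendistribution c) F p := by
  rw [tensionField_eq_gramTrace hF]
  refine map_gramTrace (h.symm p) (secondFundamentalTensor h g F p) _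
    (ε • (Q (F p)).toLinearMap) c fun v hv ↦ ?_
  have hv' : P p v = c • v := Module.End.mem_eigenspace_iff.mp hv
  have := secondFundamentalTensor_comp hF hP hQ hPQ p v
  rw [hv', map_smul] at this
  exact this.symm

end ProductGeometry

end

theorem mainTheorem10
    {E : Type*} [NormedAddCommGroup E] [NormedSpace ℝ E] [FiniteDimensional ℝ E]
    {M : Type*} [TopologicalSpace M] [ChartedSpace E M] [IsManifold 𝓘(ℝ, E) ∞ M]
    {E' : Type*} [NormedAddCommGroup E'] [NormedSpace ℝ E'] [FiniteDimensional ℝ E']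
    {N : Type*} [TopologicalSpace N] [ChartedSpace E' N] [IsManifold 𝓘(ℝ, E') ∞ N]
    (h : ProductGeometry.SemiRiemannianMetric E M)
    (P : ProductGeometry.AlmostProductStructure E M)
    (g : ProductGeometry.SemiRiemannianMetric E' N)
    (Q : ProductGeometry.AlmostProductStructure E' N)
    (F : M → N) (hF : ContMDiff 𝓘(ℝ, E) 𝓘(ℝ, E') ∞ F)
    (hM : ProductGeometry.IsLocallyDecomposableProductRiemannian h P)
    (hN : ProductGeometry.IsLocallyDecomposableProductRiemannian g Q ∨
      ProductGeometry.IsNearlyParaKaehler g Q)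
    (hPQ : ProductGeometry.IsParaholomorphic P Q F ∨
      ProductGeometry.IsAntiParaholomorphic P Q F) :
    ProductGeometry.IsHarmonic h g F ↔
      ProductGeometry.IsPlusEigenHarmonic h g P F ∧
        ProductGeometry.IsMinusEigenHarmonic h g P F := by
  have hP := ProductGeometry.AlmostProductStructure.nablaTensor_eq_zero hM
  -- The two classes of target enter only through this diagonal vanishing.
  have hQ : ∀ (q : N) (v : TangentSpace 𝓘(ℝ, E') q), Q.nablaTensor g q v v = 0 := fun q v ↦
    hN.elim (fun hN ↦ ProductGeometry.AlmostProductStructure.nablaTensor_eq_zero hN q v v)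
      fun hN ↦ hN.nablaTensor_self q v
  have hε : ∃ ε : ℝ, ∀ (p : M) (v : TangentSpace 𝓘(ℝ, E) p),
      mfderiv 𝓘(ℝ, E) 𝓘(ℝ, E') F p (P p v) = ε • Q (F p) (mfderiv 𝓘(ℝ, E) 𝓘(ℝ, E') F p v) := by
    rcases hPQ with hPQ | hPQ
    · exact ⟨1, fun p v ↦ by rw [hPQ p v, one_smul]⟩
    · exact ⟨-1, fun p v ↦ by rw [hPQ p v, neg_one_smul]⟩
  obtain ⟨ε, hε⟩ := hε
  have hsum := ProductGeometry.tensionField_top (g := g) hF hM.toIsAlmostProductRiemannian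
  constructor
  · intro hH
    have key (p : M) : ProductGeometry.tensionField h g (P.eigendistribution 1) F p = 0 ∧
        ProductGeometry.tensionField h g (P.eigendistribution (-1)) F p = 0 := by
      have h0 := (hsum p).symm.trans (hH p)
      have h1 := ProductGeometry.smul_apply_tensionField_eigendistribution hF hP hQ hε 1 p
      have h2 := ProductGeometry.smul_apply_tensionField_eigendistribution hF hP hQ hε (-1) p
      -- Substituting τ₋ = -τ₊ into the relation for the eigenvalue -1 and using the one for 1
      -- yields -τ₊ = τ₊.
      rw [eq_neg_of_add_eq_zero_right h0, map_neg, smul_neg, h1] at h2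
      have h3 : ProductGeometry.tensionField h g (P.eigendistribution 1) F p = 0 := by
        have : (2 : ℝ) • ProductGeometry.tensionField h g (P.eigendistribution 1) F p = 0 := by
          linear_combination (norm := module) -h2
        exact (smul_eq_zero.mp this).resolve_left two_ne_zero
      exact ⟨h3, by rwa [h3, zero_add] at h0⟩
    exact ⟨fun p ↦ (key p).1, fun p ↦ (key p).2⟩
  · rintro ⟨h1, h2⟩ p
    exact (hsum p).trans (by rw [h1 p, h2 p, add_zero])
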